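/- Let $\alpha,\beta>-1$ and $w(x)=(1-x)^{\alpha}(1+x)^{\beta}$ on $[-1,1]$. There is exactly one sequence $(P_n)_{n\ge 0}$ of real polynomials, the monic Jacobi polynomials, such that $P_n$ is monic of degree $n$ and $\int_{-1}^{1}P_m(x)P_n(x)w(x)\,dx=0$ for $m\ne n$. There are unique real sequences $(\alpha_n)_{n\ge0}$, $(\beta_n)_{n\ge0}$ with $\beta_0=0$ and $$xP_n(x)=P_{n+1}(x)+\alpha_nP_n(x)+\beta_nP_{n-1}(x)\qquad(n\ge 0),$$ where the last term is absent for $n=0$. Put $h_n=\int_{-1}^{1}P_n(x)^2w(x)\,dx$ and $R_n=\tfrac12(\alpha+\beta+2n+1)$ for $n\ge-1$. Then: 1. If $\beta>0$, then for every $n\ge 0$ the following integral converges and $\displaystyle R_n=\frac{\beta}{h_n}\int_{-1}^{1}\frac{P_n(y)^2}{1+y}\,w(y)\,dy$. 2. For every $n\ge 0$, $\displaystyle \beta_{n+1}R_{n+1}-\beta_nR_{n-1}=\frac{1-\alpha_n^2}{2}$. 3. $\displaystyle \beta_1=\frac{4(\alpha+1)(\beta+1)}{(\alpha+\beta+2)^2(\alpha+\beta+3)}$,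 and $(\beta_n)_{n\ge1}$ is the only sequence with this initial value that satisfies the linear difference equation in 2 for all $n\ge 1$. 4. For every $n\ge 1$, $$\beta_n=\frac{4n(n+\alpha)(n+\beta)(n+\alpha+\beta)}{(2n+\alpha+\beta)^2(2n+\alpha+\beta+1)(2n+\alpha+\beta-1)},$$ except that for $n=1$ and $\alpha+\beta=-1$, where the right-hand side has the form $0/0$, the value of $\beta_1$ is the one given in 3. -/

import Mathlib

noncomputable section

/-- The Jacobi weight `(1 - x)^α (1 + x)^β`, used for `x ∈ [-1, 1]`. -/
def jacobiWeight (α β x : ℝ) : ℝ := (1 - x) ^ α * (1 + x) ^ β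

/-- `P` is the sequence of monic Jacobi polynomials: `P n` is monic of degree `n`, and distinct
members are orthogonal on `[-1, 1]` with respect to the Jacobi weight. -/
def IsMonicJacobi (α β : ℝ) (P : ℕ → Polynomial ℝ) : Prop :=
  (∀ n, (P n).Monic ∧ (P n).natDegree = n) ∧
    ∀ m n, m ≠ n → ∫ x in (-1 : ℝ)..1, (P m).eval x * (P n).eval x * jacobiWeight α β x = 0

/-- The squared norm `h_n = ∫ P_n² w`. -/
def jacobiNorm (α β : ℝ) (P : ℕ → Polynomial ℝ) (n : ℕ) : ℝ :=
  ∫ x in (-1 : ℝ)..1, (P n).eval x ^ 2 * jacobiWeight α β x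

/-- `a` and `b` are the diagonal and off-diagonal coefficients of the three-term recurrence
`x P_n = P_{n+1} + a_n P_n + b_n P_{n-1}`, `n ≥ 0`, with the convention that the last term is
absent for `n = 0`, that is, `b_0 = 0`. -/
def IsRecurrence (P : ℕ → Polynomial ℝ) (a b : ℕ → ℝ) : Prop :=
  b 0 = 0 ∧
    Polynomial.X * P 0 = P 1 + Polynomial.C (a 0) * P 0 ∧
    ∀ n, Polynomial.X * P (n + 1) =
      P (n + 2) + Polynomial.C (a (n + 1)) * P (n + 1) + Polynomial.C (b (n + 1)) * P n

/-- `R_n = (α + β + 2n + 1) / 2`; an integer index, since `R_{-1}` occurs. -/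
def jacobiR (α β : ℝ) (n : ℤ) : ℝ := (α + β + 2 * n + 1) / 2

end

/-! ### Jacobi weight: integrability, positivity, integration by parts. -/

section Analysis

open Polynomial intervalIntegral MeasureTheory

/-! Integration against the weight is a positive definite functional `L` on polynomials, which gives
existence and uniqueness of `P n` and of its recurrence coefficients. The Pearson identity
(`jacobiFunctional_pearson`) makes a second-order operator, triangular in the degree, symmetric for
`L`; hence each `P n` is an eigenvector (`jacobiOperator_eq`). Comparing coefficients in the
eigenvalue equation yields the two coefficients of `P n` below the leading one, and these determine
`a` and `b` in closed form. The difference equation is then a rational identity between closed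
forms; it determines `b` because `R_{n+1} ≠ 0`. The integral formula for `R_n` is the Pearson
identity for the parameters `α`, `β - 1`, applied to `P n ^ 2`. -/

theorem intervalIntegrable_jacobiWeight {α β : ℝ} (hα : -1 < α) (hβ : -1 < β) :
    IntervalIntegrable (jacobiWeight α β) volume (-1) 1 := by
  have hleft : IntervalIntegrable (fun x : ℝ => (1 + x) ^ β) volume (-1) 0 := by
    have h := (intervalIntegrable_rpow' (a := 0) (b := 1) hβ).comp_add_left 1
    simpa using h
  have hright : IntervalIntegrable (fun x : ℝ => (1 - x) ^ α) volume 0 1 := by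
    have h := (intervalIntegrable_rpow' (a := 1) (b := 0) hα).comp_sub_left 1
    simpa using h
  have h₁ : IntervalIntegrable (jacobiWeight α β) volume (-1) 0 := by
    refine hleft.continuousOn_mul (g := fun x : ℝ => (1 - x) ^ α) ?_
    intro x hx
    rw [Set.uIcc_of_le (by norm_num)] at hx
    refine ContinuousAt.continuousWithinAt ?_
    refine ContinuousAt.rpow_const (by fun_prop) (Or.inl ?_)
    linarith [hx.2]
  have h₂ : IntervalIntegrable (jacobiWeight α β) volume 0 1 := by
    refine hright.mul_continuousOn (g := fun x : ℝ => (1 + x) ^ β) ?_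
    intro x hx
    rw [Set.uIcc_of_le (by norm_num)] at hx
    refine ContinuousAt.continuousWithinAt ?_
    refine ContinuousAt.rpow_const (by fun_prop) (Or.inl ?_)
    linarith [hx.1]
  exact h₁.trans h₂

theorem intervalIntegrable_eval_mul_jacobiWeight {α β : ℝ} (hα : -1 < α) (hβ : -1 < β)
    (p : ℝ[X]) :
    IntervalIntegrable (fun x => p.eval x * jacobiWeight α β x) volume (-1) 1 :=
  (intervalIntegrable_jacobiWeight hα hβ).continuousOn_mul p.continuous.continuousOn

/-- Integration against the Jacobi weight, as a linear functional on polynomials. -/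
noncomputable def jacobiFunctional {α β : ℝ} (hα : -1 < α) (hβ : -1 < β) : ℝ[X] →ₗ[ℝ] ℝ where
  toFun p := ∫ x in (-1 : ℝ)..1, p.eval x * jacobiWeight α β x
  map_add' p q := by
    rw [← integral_add (intervalIntegrable_eval_mul_jacobiWeight hα hβ p)
      (intervalIntegrable_eval_mul_jacobiWeight hα hβ q)]
    simp only [eval_add, add_mul]
  map_smul' c p := by
    simp only [eval_smul, smul_eq_mul, mul_assoc, intervalIntegral.integral_const_mul, RingHom.id_apply]

theorem jacobiFunctional_apply {α β : ℝ} (hα : -1 < α) (hβ : -1 < β) (p : ℝ[X]) :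
    jacobiFunctional hα hβ p = ∫ x in (-1 : ℝ)..1, p.eval x * jacobiWeight α β x := rfl

theorem jacobiWeight_pos {α β x : ℝ} (h₁ : -1 < x) (h₂ : x < 1) : 0 < jacobiWeight α β x :=
  mul_pos (Real.rpow_pos_of_pos (by linarith) _) (Real.rpow_pos_of_pos (by linarith) _)

theorem jacobiFunctional_mul_self_pos {α β : ℝ} (hα : -1 < α) (hβ : -1 < β) {p : ℝ[X]}
    (hp : p ≠ 0) : 0 < jacobiFunctional hα hβ (p * p) := by
  rw [jacobiFunctional_apply, integral_pos_iff_support_of_nonneg_ae']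
  · refine ⟨by norm_num, ?_⟩
    have hsub : Set.Ioo (-1 : ℝ) 1 \ {x | p.IsRoot x} ⊆
        (Function.support fun x => (p * p).eval x * jacobiWeight α β x) ∩ Set.Ioc (-1) 1 := by
      rintro x ⟨hx, hr⟩
      refine ⟨?_, hx.1, hx.2.le⟩
      have hr' : p.eval x ≠ 0 := hr
      simp [hr', (jacobiWeight_pos (α := α) (β := β) hx.1 hx.2).ne']
    refine lt_of_lt_of_le ?_ (measure_mono hsub)
    rw [measure_sdiff_null ((finite_setOfPred_isRoot hp).measure_zero _)]
    simp
  · rw [Set.uIoc_of_le (by norm_num)]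
    refine (ae_restrict_iff' measurableSet_Ioc).2 (Filter.Eventually.of_forall fun x hx => ?_)
    simp only [eval_mul, Pi.zero_apply]
    refine mul_nonneg (mul_self_nonneg _) (mul_nonneg ?_ ?_)
    · exact Real.rpow_nonneg (by linarith [hx.2]) _
    · exact Real.rpow_nonneg (by linarith [hx.1]) _
  · exact intervalIntegrable_eval_mul_jacobiWeight hα hβ _

/-- The Pearson identity for the Jacobi weight. -/
theorem jacobiFunctional_pearson {α β : ℝ} (hα : -1 < α) (hβ : -1 < β) (p : ℝ[X]) :
    jacobiFunctional hα hβ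
      ((1 - X ^ 2) * derivative p + (C (β - α) - C (α + β + 2) * X) * p) = 0 := by
  rw [jacobiFunctional_apply]
  -- The integrand is the derivative of this function, which vanishes at both endpoints since `α +
  -- 1` and `β + 1` are positive.
  have hcont : ContinuousOn (fun x : ℝ => p.eval x * ((1 - x) ^ (α + 1) * (1 + x) ^ (β + 1)))
      (Set.Icc (-1) 1) := by
    refine (p.continuous.mul (Continuous.mul ?_ ?_)).continuousOn
    · exact Continuous.rpow_const (by fun_prop) fun x => Or.inr (by linarith)
    · exact Continuous.rpow_const (by fun_prop) fun x => Or.inr (by linarith)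
  rw [integral_eq_sub_of_hasDerivAt_of_le (by norm_num) hcont ?_
    (intervalIntegrable_eval_mul_jacobiWeight hα hβ _)]
  · simp [Real.zero_rpow (show α + 1 ≠ 0 by linarith), Real.zero_rpow (show β + 1 ≠ 0 by linarith)]
  · intro x hx
    have h₁ : 0 < 1 - x := by linarith [hx.2]
    have h₂ : 0 < 1 + x := by linarith [hx.1]
    have d₁ : HasDerivAt (fun y : ℝ => (1 - y) ^ (α + 1)) (-(α + 1) * (1 - x) ^ α) x := by
      have h := ((hasDerivAt_id' x).const_sub 1).rpow_const (p := α + 1) (Or.inl h₁.ne')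
      exact h.congr_deriv (by rw [add_sub_cancel_right]; ring)
    have d₂ : HasDerivAt (fun y : ℝ => (1 + y) ^ (β + 1)) ((β + 1) * (1 + x) ^ β) x := by
      have h := ((hasDerivAt_id' x).const_add 1).rpow_const (p := β + 1) (Or.inl h₂.ne')
      exact h.congr_deriv (by rw [add_sub_cancel_right]; ring)
    refine ((p.hasDerivAt x).mul (d₁.mul d₂)).congr_deriv ?_
    simp only [jacobiWeight, eval_add, eval_mul, eval_sub, eval_one, eval_pow, eval_X, eval_C,
      Real.rpow_add_one h₁.ne', Real.rpow_add_one h₂.ne', Pi.mul_apply]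
    ring

end Analysis

/-! ### Monic orthogonal polynomials of a positive definite functional. -/

section Algebra

open Polynomial

/-- `P n` is monic of degree `n` and the `P n` are pairwise orthogonal for the functional `L`. -/
structure IsMonicOrthogonal (L : ℝ[X] →ₗ[ℝ] ℝ) (P : ℕ → ℝ[X]) : Prop where
  monic : ∀ n, (P n).Monic
  natDegree_eq : ∀ n, (P n).natDegree = n
  orthogonal : ∀ m n, m ≠ n → L (P m * P n) = 0

theorem apply_C_mul (L : ℝ[X] →ₗ[ℝ] ℝ) (c : ℝ) (p : ℝ[X]) : L (C c * p) = c * L p := by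
  rw [← smul_eq_C_mul, map_smul, smul_eq_mul]

/-- Definiteness makes `(p, q) ↦ L (p * q)` nondegenerate in degree below `n`, so some `r` there
represents `q ↦ L (X ^ n * q)`; take `X ^ n - r`. -/
theorem exists_monic_orthogonal_degree_lt {L : ℝ[X] →ₗ[ℝ] ℝ}
    (hL : ∀ p, p ≠ 0 → 0 < L (p * p)) (n : ℕ) :
    ∃ p : ℝ[X], p.Monic ∧ p.natDegree = n ∧ ∀ q : ℝ[X], q.degree < n → L (p * q) = 0 := by
  have : FiniteDimensional ℝ (degreeLT ℝ n) := (degreeLTEquiv ℝ n).symm.finiteDimensional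
  let B : degreeLT ℝ n →ₗ[ℝ] Module.Dual ℝ (degreeLT ℝ n) :=
    LinearMap.mk₂ ℝ (fun p q => L ((p : ℝ[X]) * q))
      (by intros; simp [add_mul]) (by intros; simp) (by intros; simp [mul_add]) (by intros; simp)
  have hinj : Function.Injective B := by
    rw [← LinearMap.ker_eq_bot, LinearMap.ker_eq_bot']
    intro p hp
    by_contra h
    have h' : (p : ℝ[X]) ≠ 0 := fun h0 => h (Subtype.ext h0)
    exact (hL _ h').ne' (LinearMap.congr_fun hp p)
  have hsurj : Function.Surjective B :=
    (LinearMap.injective_iff_surjective_of_finrank_eq_finrank Subspace.dual_finrank_eq.symm).1 hinj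
  obtain ⟨r, hr⟩ := hsurj
    ((L ∘ₗ LinearMap.mulLeft ℝ (X ^ n : ℝ[X])) ∘ₗ (degreeLT ℝ n).subtype)
  have hdeg : (r : ℝ[X]).degree < n := mem_degreeLT.1 r.2
  refine ⟨X ^ n - (r : ℝ[X]), monic_X_pow_sub hdeg, ?_, fun q hq => ?_⟩
  · exact natDegree_eq_of_degree_eq_some (by
      rw [degree_sub_eq_left_of_degree_lt (by simpa using hdeg), degree_X_pow])
  · have h := LinearMap.congr_fun hr ⟨q, mem_degreeLT.2 hq⟩
    have h' : L ((r : ℝ[X]) * q) = L (X ^ n * q) := h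
    rw [sub_mul, map_sub, h', sub_self]

namespace IsMonicOrthogonal

variable {L : ℝ[X] →ₗ[ℝ] ℝ} {P : ℕ → ℝ[X]}

theorem coeff_self (hP : IsMonicOrthogonal L P) (n : ℕ) : (P n).coeff n = 1 := by
  have h := hP.monic n
  rwa [Monic, leadingCoeff, hP.natDegree_eq] at h

theorem coeff_of_lt (hP : IsMonicOrthogonal L P) {m n : ℕ} (h : n < m) : (P n).coeff m = 0 :=
  coeff_eq_zero_of_natDegree_lt (by rwa [hP.natDegree_eq])

theorem degree_sub_lt (hP : IsMonicOrthogonal L P) {q : ℝ[X]} {n : ℕ} (hq : q.degree < ((n + 1 : ℕ) : WithBot ℕ)) :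
    (q - C (q.coeff n) * P n).degree < n := by
  rw [degree_lt_iff_coeff_zero] at hq ⊢
  intro m hm
  rcases hm.eq_or_lt with rfl | hm
  · simp [hP.coeff_self]
  · simp [hP.coeff_of_lt hm, hq m hm]

theorem eq_zero_of_degree_lt (hP : IsMonicOrthogonal L P) (n : ℕ) {q : ℝ[X]} (hq : q.degree < n) :
    ∀ N, n ≤ N → L (P N * q) = 0 := by
  induction n generalizing q with
  | zero =>
    have : q = 0 := by simpa using hq
    simp [this]
  | succ k ih =>
    intro N hN
    have h := ih (hP.degree_sub_lt hq) N (by omega)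
    rw [mul_sub, map_sub, mul_left_comm, ← smul_eq_C_mul, map_smul,
      hP.orthogonal N k (by omega)] at h
    simpa using h

theorem apply_mul_eq_zero (hP : IsMonicOrthogonal L P) {n : ℕ} {q : ℝ[X]} (hq : q.degree < n) :
    L (P n * q) = 0 :=
  hP.eq_zero_of_degree_lt n hq n le_rfl

theorem exists_of_pos (hL : ∀ p, p ≠ 0 → 0 < L (p * p)) : ∃ P, IsMonicOrthogonal L P := by
  choose P hmon hdeg horth using exists_monic_orthogonal_degree_lt hL
  have hlt : ∀ m n, m < n → L (P n * P m) = 0 := fun m n h =>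
    horth n _ ((degree_le_natDegree).trans_lt (by rw [hdeg]; exact_mod_cast h))
  refine ⟨P, hmon, hdeg, fun m n h => ?_⟩
  rcases h.lt_or_gt with h | h
  · rw [mul_comm, hlt m n h]
  · exact hlt n m h

theorem unique (hL : ∀ p, p ≠ 0 → 0 < L (p * p)) {Q : ℕ → ℝ[X]} (hP : IsMonicOrthogonal L P)
    (hQ : IsMonicOrthogonal L Q) : P = Q := by
  funext n
  by_contra h
  have hD : (P n - Q n).degree < n := by
    rw [degree_lt_iff_coeff_zero]
    intro m hm
    rcases hm.eq_or_lt with rfl | hm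
    · simp [hP.coeff_self, hQ.coeff_self]
    · simp [hP.coeff_of_lt hm, hQ.coeff_of_lt hm]
  refine (hL _ (sub_ne_zero.2 h)).ne' ?_
  rw [sub_mul, map_sub, hP.apply_mul_eq_zero hD, hQ.apply_mul_eq_zero hD, sub_zero]

theorem apply_zero_eq (hP : IsMonicOrthogonal L P) : P 0 = 1 :=
  (hP.monic 0).natDegree_eq_zero.1 (hP.natDegree_eq 0)

theorem degree_X_mul_lt {q : ℝ[X]} {n : ℕ} (hq : q.degree < n) : (X * q).degree < ((n + 1 : ℕ) : WithBot ℕ) := by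
  rw [degree_lt_iff_coeff_zero] at hq ⊢
  intro m hm
  obtain ⟨k, rfl⟩ : ∃ k, m = k + 1 := ⟨m - 1, by omega⟩
  rw [coeff_X_mul]
  exact hq k (by omega)

/-- Choose `a`, `b` to cancel the top coefficients, leaving a remainder `D` of degree below `n`.
Moving `X` onto `D` shows that `D` is orthogonal to every term composing it, so `L (D * D) = 0`. -/
theorem exists_recurrence (hL : ∀ p, p ≠ 0 → 0 < L (p * p)) (hP : IsMonicOrthogonal L P) (n : ℕ) :
    ∃ a b : ℝ, X * P (n + 1) = P (n + 2) + C a * P (n + 1) + C b * P n := by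
  have h₂ : (X * P (n + 1) - P (n + 2)).degree < ((n + 2 : ℕ) : WithBot ℕ) := by
    rw [degree_lt_iff_coeff_zero]
    intro m hm
    obtain ⟨k, rfl⟩ : ∃ k, m = k + 1 := ⟨m - 1, by omega⟩
    rw [coeff_sub, coeff_X_mul]
    rcases hm.eq_or_lt with h | h
    · obtain rfl : k = n + 1 := by omega
      rw [hP.coeff_self, hP.coeff_self, sub_self]
    · rw [hP.coeff_of_lt (by omega), hP.coeff_of_lt (by omega), sub_self]
  have h₁ := hP.degree_sub_lt h₂
  set a := (X * P (n + 1) - P (n + 2)).coeff (n + 1)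
  have h₀ := hP.degree_sub_lt h₁
  set b := (X * P (n + 1) - P (n + 2) - C a * P (n + 1)).coeff n
  refine ⟨a, b, ?_⟩
  rw [← sub_eq_zero, ← sub_sub, ← sub_sub]
  by_contra hne
  refine (hL _ hne).ne' ?_
  generalize hD : X * P (n + 1) - P (n + 2) - C a * P (n + 1) - C b * P n = D at h₀ ⊢
  have e₁ : L (P (n + 1) * (X * D)) = 0 := hP.apply_mul_eq_zero (degree_X_mul_lt h₀)
  have e₂ : L (P (n + 2) * D) = 0 := hP.eq_zero_of_degree_lt n h₀ _ (by omega)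
  have e₃ : L (P (n + 1) * D) = 0 := hP.eq_zero_of_degree_lt n h₀ _ (by omega)
  have e₄ : L (P n * D) = 0 := hP.apply_mul_eq_zero h₀
  have e : D * D = P (n + 1) * (X * D) - P (n + 2) * D - C a * (P (n + 1) * D) -
      C b * (P n * D) := by
    nth_rewrite 1 [← hD]
    ring
  rw [e, map_sub, map_sub, map_sub, apply_C_mul, apply_C_mul, e₁, e₂, e₃, e₄]
  ring

theorem exists_isRecurrence (hL : ∀ p, p ≠ 0 → 0 < L (p * p)) (hP : IsMonicOrthogonal L P) :
    ∃ a b, IsRecurrence P a b := by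
  choose a b h using hP.exists_recurrence hL
  refine ⟨fun | 0 => -(P 1).coeff 0 | n + 1 => a n, fun | 0 => 0 | n + 1 => b n, rfl, ?_, h⟩
  have h₁ : P 1 = X + C ((P 1).coeff 0) := by
    conv_lhs => rw [eq_X_add_C_of_natDegree_le_one (hP.natDegree_eq 1).le]
    simp [hP.coeff_self]
  rw [hP.apply_zero_eq]
  nth_rewrite 1 [h₁]
  simp

theorem recurrence_coeff_zero (hP : IsMonicOrthogonal L P) {a b : ℕ → ℝ} (h : IsRecurrence P a b) :
    a 0 = -(P 1).coeff 0 := by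
  have := congrArg (coeff · 0) h.2.1
  simp [hP.apply_zero_eq] at this
  linarith

theorem recurrence_coeff_succ (hP : IsMonicOrthogonal L P) {a b : ℕ → ℝ} (h : IsRecurrence P a b)
    (n : ℕ) : a (n + 1) = (P (n + 1)).coeff n - (P (n + 2)).coeff (n + 1) := by
  have := congrArg (coeff · (n + 1)) (h.2.2 n)
  simp only [coeff_X_mul, coeff_add, coeff_C_mul, hP.coeff_self,
    hP.coeff_of_lt (Nat.lt_succ_self n)] at this
  linarith

/-- Separate from the general index because `X * P 1` has no constant term. -/
theorem recurrence_offDiag_one (hP : IsMonicOrthogonal L P) {a b : ℕ → ℝ}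
    (h : IsRecurrence P a b) : b 1 = -(P 2).coeff 0 - a 1 * (P 1).coeff 0 := by
  have := congrArg (coeff · 0) (h.2.2 0)
  simp [hP.apply_zero_eq] at this
  linarith

theorem recurrence_offDiag_succ (hP : IsMonicOrthogonal L P) {a b : ℕ → ℝ}
    (h : IsRecurrence P a b) (n : ℕ) : b (n + 2) =
      (P (n + 2)).coeff n - (P (n + 3)).coeff (n + 1) - a (n + 2) * (P (n + 2)).coeff (n + 1) := by
  have := congrArg (coeff · (n + 1)) (h.2.2 (n + 1))
  simp only [coeff_X_mul, coeff_add, coeff_C_mul, hP.coeff_self] at this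
  linarith

theorem isRecurrence_unique (hP : IsMonicOrthogonal L P) {a b a' b' : ℕ → ℝ}
    (h : IsRecurrence P a b) (h' : IsRecurrence P a' b') : a = a' ∧ b = b' := by
  have ha : a = a' := by
    funext n
    cases n with
    | zero => rw [hP.recurrence_coeff_zero h, hP.recurrence_coeff_zero h']
    | succ n => rw [hP.recurrence_coeff_succ h, hP.recurrence_coeff_succ h']
  refine ⟨ha, funext fun n => ?_⟩
  match n with
  | 0 => rw [h.1, h'.1]
  | 1 => rw [hP.recurrence_offDiag_one h, hP.recurrence_offDiag_one h', ha]
  | n + 2 => rw [hP.recurrence_offDiag_succ h, hP.recurrence_offDiag_succ h', ha]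

end IsMonicOrthogonal

/-! ### The differential operator and its eigenpolynomials. -/

/-- The Jacobi differential operator `(1 - x²) p'' + (d - (s + 2) x) p'`, where `d = β - α` and
`s = α + β`. -/
noncomputable def jacobiOperator (d s : ℝ) (p : ℝ[X]) : ℝ[X] :=
  (1 - X ^ 2) * derivative (derivative p) + (C d - C (s + 2) * X) * derivative p

theorem coeff_jacobiOperator (d s : ℝ) (p : ℝ[X]) (k : ℕ) :
    (jacobiOperator d s p).coeff k = (k + 2) * (k + 1) * p.coeff (k + 2) +
      d * (k + 1) * p.coeff (k + 1) - k * (k + 1 + s) * p.coeff k := by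
  have h₁ : (X * derivative p).coeff k = k * p.coeff k := by
    cases k with
    | zero => simp
    | succ k => rw [coeff_X_mul, coeff_derivative]; push_cast; ring
  have h₂ : (X ^ 2 * derivative (derivative p)).coeff k = k * (k - 1) * p.coeff k := by
    match k with
    | 0 => simp [pow_two, mul_assoc]
    | 1 => simp [pow_two, mul_assoc, coeff_X_mul]
    | k + 2 =>
      rw [coeff_X_pow_mul, coeff_derivative, coeff_derivative]; push_cast; ring
  rw [jacobiOperator, sub_mul, one_mul, sub_mul, mul_assoc, coeff_add, coeff_sub, coeff_sub,
    coeff_C_mul, coeff_C_mul, h₁, h₂, coeff_derivative, coeff_derivative, coeff_derivative]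
  push_cast
  ring

theorem degree_jacobiOperator_lt {d s : ℝ} {p : ℝ[X]} {n : ℕ} (hp : p.degree < n) :
    (jacobiOperator d s p).degree < n := by
  rw [degree_lt_iff_coeff_zero] at hp ⊢
  intro m hm
  rw [coeff_jacobiOperator, hp m hm, hp (m + 1) (by omega), hp (m + 2) (by omega)]
  ring

/-- Lagrange's identity: the difference of the two sides is the Pearson expression of the Wronskian
`p' q - p q'`. -/
theorem apply_jacobiOperator_mul {L : ℝ[X] →ₗ[ℝ] ℝ} {d s : ℝ}
    (hS : ∀ p, L ((1 - X ^ 2) * derivative p + (C d - C (s + 2) * X) * p) = 0) (p q : ℝ[X]) :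
    L (jacobiOperator d s p * q) = L (p * jacobiOperator d s q) := by
  rw [← sub_eq_zero, ← map_sub, ← hS (derivative p * q - p * derivative q)]
  congr 1
  simp only [jacobiOperator, derivative_sub, derivative_mul]
  ring

namespace IsMonicOrthogonal

variable {L : ℝ[X] →ₗ[ℝ] ℝ} {P : ℕ → ℝ[X]} {d s : ℝ}

/-- The defect `D` has degree below `n`, and by symmetry `P n` is orthogonal to both `D` and its
image, so `L (D * D) = 0`. -/
theorem jacobiOperator_eq (hL : ∀ p, p ≠ 0 → 0 < L (p * p))
    (hS : ∀ p, L ((1 - X ^ 2) * derivative p + (C d - C (s + 2) * X) * p) = 0)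
    (hP : IsMonicOrthogonal L P) (n : ℕ) :
    jacobiOperator d s (P n) = C (-(n * (n + 1 + s))) * P n := by
  rw [← sub_eq_zero]
  by_contra hne
  refine (hL _ hne).ne' ?_
  set D := jacobiOperator d s (P n) - C (-(n * (n + 1 + s))) * P n with hD
  have hdeg : D.degree < n := by
    rw [degree_lt_iff_coeff_zero]
    intro m hm
    rw [hD, coeff_sub, coeff_jacobiOperator, coeff_C_mul, hP.coeff_of_lt (by omega : n < m + 1),
      hP.coeff_of_lt (by omega : n < m + 2)]
    rcases hm.eq_or_lt with rfl | hm
    · ring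
    · rw [hP.coeff_of_lt hm]; ring
  have e : D * D = jacobiOperator d s (P n) * D - C (-(n * (n + 1 + s))) * (P n * D) := by
    nth_rewrite 1 [hD]
    ring
  rw [e, map_sub, apply_C_mul, apply_jacobiOperator_mul hS, hP.apply_mul_eq_zero hdeg,
    hP.apply_mul_eq_zero (degree_jacobiOperator_lt hdeg), mul_zero, sub_zero]

/-- The denominator is the gap between the eigenvalues of degrees `n` and `n + 1`, positive since `s
> -2`. -/
theorem coeff_pred (hL : ∀ p, p ≠ 0 → 0 < L (p * p))
    (hS : ∀ p, L ((1 - X ^ 2) * derivative p + (C d - C (s + 2) * X) * p) = 0)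
    (hP : IsMonicOrthogonal L P) (hs : -2 < s) (n : ℕ) :
    (P (n + 1)).coeff n = -(d * (n + 1)) / (2 * n + 2 + s) := by
  have h := congrArg (coeff · n) (hP.jacobiOperator_eq hL hS (n + 1))
  simp only [coeff_jacobiOperator, coeff_C_mul, hP.coeff_self,
    hP.coeff_of_lt (by omega : n + 1 < n + 2)] at h
  have hn : (0 : ℝ) ≤ n := n.cast_nonneg
  rw [eq_div_iff (by linarith)]
  push_cast at h
  linear_combination h

theorem coeff_pred_pred (hL : ∀ p, p ≠ 0 → 0 < L (p * p))
    (hS : ∀ p, L ((1 - X ^ 2) * derivative p + (C d - C (s + 2) * X) * p) = 0)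
    (hP : IsMonicOrthogonal L P) (hs : -2 < s) (n : ℕ) :
    (P (n + 2)).coeff n =
      -((n + 1) * (n + 2 - d ^ 2 * (n + 2) / (2 * n + 4 + s))) / (2 * (2 * n + 3 + s)) := by
  have h := congrArg (coeff · n) (hP.jacobiOperator_eq hL hS (n + 2))
  simp only [coeff_jacobiOperator, coeff_C_mul, hP.coeff_self,
    hP.coeff_pred hL hS hs (n + 1)] at h
  have hn : (0 : ℝ) ≤ n := n.cast_nonneg
  have hne : 2 * (n : ℝ) + 4 + s ≠ 0 := by linarith
  rw [eq_div_iff (by linarith)]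
  push_cast at h
  rw [show 2 * ((n : ℝ) + 1) + 2 + s = 2 * n + 4 + s by ring] at h
  linear_combination h

end IsMonicOrthogonal

end Algebra

/-! ### Closed forms and the difference equation for the Jacobi weight. -/

section Jacobi

open Polynomial intervalIntegral MeasureTheory

variable {α β : ℝ} {P : ℕ → ℝ[X]} {a b : ℕ → ℝ}

theorem isMonicJacobi_iff (hα : -1 < α) (hβ : -1 < β) :
    IsMonicJacobi α β P ↔ IsMonicOrthogonal (jacobiFunctional hα hβ) P := by
  constructor
  · rintro ⟨h₁, h₂⟩
    refine ⟨fun n => (h₁ n).1, fun n => (h₁ n).2, fun m n h => ?_⟩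
    simpa [jacobiFunctional_apply] using h₂ m n h
  · rintro ⟨h₁, h₂, h₃⟩
    refine ⟨fun n => ⟨h₁ n, h₂ n⟩, fun m n h => ?_⟩
    simpa [jacobiFunctional_apply] using h₃ m n h

theorem jacobiNorm_eq (hα : -1 < α) (hβ : -1 < β) (n : ℕ) :
    jacobiNorm α β P n = jacobiFunctional hα hβ (P n * P n) := by
  simp only [jacobiNorm, jacobiFunctional_apply, eval_mul, pow_two]

theorem div_mul_jacobiWeight {x : ℝ} (hx : -1 < x) (y : ℝ) :
    y / (1 + x) * jacobiWeight α β x = y * jacobiWeight α (β - 1) x := by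
  have h : 0 < 1 + x := by linarith
  rw [jacobiWeight, jacobiWeight, Real.rpow_sub_one h.ne']
  ring

theorem jacobiFunctional_sub_one (hα : -1 < α) (hβ : -1 < β) (hβ' : -1 < β - 1) (p : ℝ[X]) :
    jacobiFunctional hα hβ' ((1 + X) * p) = jacobiFunctional hα hβ p := by
  rw [jacobiFunctional_apply, jacobiFunctional_apply]
  refine integral_congr_ae (Filter.Eventually.of_forall fun x hx => ?_)
  rw [Set.uIoc_of_le (by norm_num)] at hx
  have h : 1 + x ≠ 0 := by linarith [hx.1]
  rw [← div_mul_jacobiWeight hx.1, eval_mul, eval_add, eval_one, eval_X, mul_div_cancel_left₀ _ h]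

theorem intervalIntegrable_div_mul_jacobiWeight (hα : -1 < α) (hβ : 0 < β) (p : ℝ[X]) :
    IntervalIntegrable (fun y => p.eval y / (1 + y) * jacobiWeight α β y) volume (-1) 1 := by
  refine (intervalIntegrable_eval_mul_jacobiWeight hα (by linarith : -1 < β - 1) p).congr ?_
  intro x hx
  rw [Set.uIoc_of_le (by norm_num)] at hx
  exact (div_mul_jacobiWeight hx.1 _).symm

theorem integral_div_mul_jacobiWeight (hα : -1 < α) (hβ' : -1 < β - 1) (p : ℝ[X]) :
    ∫ y in (-1 : ℝ)..1, p.eval y / (1 + y) * jacobiWeight α β y =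
      jacobiFunctional hα hβ' p := by
  rw [jacobiFunctional_apply]
  refine integral_congr_ae (Filter.Eventually.of_forall fun x hx => ?_)
  rw [Set.uIoc_of_le (by norm_num)] at hx
  exact div_mul_jacobiWeight hx.1 _

theorem IsMonicOrthogonal.apply_mul_derivative {L : ℝ[X] →ₗ[ℝ] ℝ} (hP : IsMonicOrthogonal L P)
    (n : ℕ) : L (P n * derivative (P n)) = 0 := by
  refine hP.apply_mul_eq_zero ?_
  rw [degree_lt_iff_coeff_zero]
  intro m hm
  rw [coeff_derivative, hP.coeff_of_lt (by omega), zero_mul]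

theorem IsMonicOrthogonal.apply_mul_X_mul_derivative {L : ℝ[X] →ₗ[ℝ] ℝ}
    (hP : IsMonicOrthogonal L P) (n : ℕ) :
    L (P n * (X * derivative (P n))) = n * L (P n * P n) := by
  have h : L (P n * (X * derivative (P n) - C (n : ℝ) * P n)) = 0 := by
    refine hP.apply_mul_eq_zero ?_
    rw [degree_lt_iff_coeff_zero]
    intro m hm
    cases m with
    | zero =>
      obtain rfl : n = 0 := by omega
      simp
    | succ k =>
      rw [coeff_sub, coeff_X_mul, coeff_derivative, coeff_C_mul]
      rcases hm.eq_or_lt with rfl | hm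
      · push_cast; ring
      · rw [hP.coeff_of_lt hm]; ring
  rwa [mul_sub, map_sub, mul_left_comm _ (C _), apply_C_mul, sub_eq_zero] at h

theorem IsMonicJacobi.two_mul_mul_integral (hα : -1 < α) (hβ : 0 < β) (hP : IsMonicJacobi α β P)
    (n : ℕ) :
    2 * β * ∫ y in (-1 : ℝ)..1, (P n).eval y ^ 2 / (1 + y) * jacobiWeight α β y =
      (α + β + 2 * n + 1) * jacobiNorm α β P n := by
  have hβ₁ : -1 < β := by linarith
  have hβ' : -1 < β - 1 := by linarith
  have hP' := (isMonicJacobi_iff hα hβ₁).1 hP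
  have hint := integral_div_mul_jacobiWeight hα hβ' (P n * P n)
  simp only [eval_mul, ← pow_two (eval _ _)] at hint
  have hS := jacobiFunctional_pearson hα hβ' (P n * P n)
  -- Everything but `2 * β * P n ^ 2` is divisible by `1 + X`, and that factor restores the weight
  -- with parameter `β`.
  have e : (1 - X ^ 2) * derivative (P n * P n) +
      (C (β - 1 - α) - C (α + (β - 1) + 2) * X) * (P n * P n) =
      (1 + X) * (C 2 * (P n * derivative (P n)) - C 2 * (P n * (X * derivative (P n))) -
        C (α + β + 1) * (P n * P n)) + C (2 * β) * (P n * P n) := by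
    simp only [derivative_mul, C_add, C_sub, C_mul, C_1, map_ofNat]
    ring
  rw [e, map_add, jacobiFunctional_sub_one hα hβ₁ hβ', map_sub, map_sub, apply_C_mul, apply_C_mul,
    apply_C_mul, apply_C_mul, hP'.apply_mul_derivative, hP'.apply_mul_X_mul_derivative] at hS
  rw [hint, jacobiNorm_eq hα hβ₁]
  linear_combination hS

theorem IsMonicJacobi.diag_zero (hα : -1 < α) (hβ : -1 < β) (hP : IsMonicJacobi α β P)
    (h : IsRecurrence P a b) : a 0 = (β - α) / (α + β + 2) := by
  have hP' := (isMonicJacobi_iff hα hβ).1 hP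
  rw [hP'.recurrence_coeff_zero h, hP'.coeff_pred (fun _ => jacobiFunctional_mul_self_pos hα hβ)
    (jacobiFunctional_pearson hα hβ) (by linarith)]
  push_cast
  rw [show 2 * (0 : ℝ) + 2 + (α + β) = α + β + 2 by ring]
  ring

theorem IsMonicJacobi.diag_succ (hα : -1 < α) (hβ : -1 < β) (hP : IsMonicJacobi α β P)
    (h : IsRecurrence P a b) (n : ℕ) :
    a (n + 1) = (β ^ 2 - α ^ 2) / ((2 * n + 2 + α + β) * (2 * n + 4 + α + β)) := by
  have hP' := (isMonicJacobi_iff hα hβ).1 hP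
  have hn : (0 : ℝ) ≤ n := n.cast_nonneg
  rw [hP'.recurrence_coeff_succ h]
  simp only [hP'.coeff_pred (fun _ => jacobiFunctional_mul_self_pos hα hβ)
    (jacobiFunctional_pearson hα hβ) (by linarith)]
  push_cast
  -- In terms of `t` the denominators become `t` and `t + 2`.
  obtain ⟨t, ht⟩ : ∃ t, 2 * (n : ℝ) + 2 + α + β = t := ⟨_, rfl⟩
  obtain rfl : α = t - 2 * n - 2 - β := by linarith
  have h₁ : t ≠ 0 := by linarith
  have h₂ : t + 2 ≠ 0 := by linarith
  rw [show 2 * (n : ℝ) + 2 + (t - 2 * n - 2 - β + β) = t by ring,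
    show 2 * ((n : ℝ) + 1) + 2 + (t - 2 * n - 2 - β + β) = t + 2 by ring,
    show 2 * (n : ℝ) + 2 + (t - 2 * n - 2 - β) + β = t by ring,
    show 2 * (n : ℝ) + 4 + (t - 2 * n - 2 - β) + β = t + 2 by ring]
  field_simp
  ring

/-- The factor `α + β + 1` never enters a denominator here, so `α + β = -1` is covered. -/
theorem IsMonicJacobi.offDiag_one (hα : -1 < α) (hβ : -1 < β) (hP : IsMonicJacobi α β P)
    (h : IsRecurrence P a b) :
    b 1 = 4 * (α + 1) * (β + 1) / ((α + β + 2) ^ 2 * (α + β + 3)) := by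
  have hP' := (isMonicJacobi_iff hα hβ).1 hP
  have hL : ∀ p, p ≠ 0 → 0 < jacobiFunctional hα hβ (p * p) :=
    fun _ => jacobiFunctional_mul_self_pos hα hβ
  rw [hP'.recurrence_offDiag_one h, hP.diag_succ hα hβ h,
    hP'.coeff_pred hL (jacobiFunctional_pearson hα hβ) (by linarith),
    hP'.coeff_pred_pred hL (jacobiFunctional_pearson hα hβ) (by linarith)]
  push_cast
  have h₂ : α + β + 2 ≠ 0 := by linarith
  have h₃ : α + β + 3 ≠ 0 := by linarith
  have h₄ : α + β + 4 ≠ 0 := by linarith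
  rw [show 2 * (0 : ℝ) + 2 + (α + β) = α + β + 2 by ring,
    show 2 * (0 : ℝ) + 2 + α + β = α + β + 2 by ring,
    show 2 * (0 : ℝ) + 3 + (α + β) = α + β + 3 by ring,
    show 2 * (0 : ℝ) + 4 + (α + β) = α + β + 4 by ring,
    show 2 * (0 : ℝ) + 4 + α + β = α + β + 4 by ring]
  field_simp
  ring

theorem IsMonicJacobi.offDiag_add_two (hα : -1 < α) (hβ : -1 < β) (hP : IsMonicJacobi α β P)
    (h : IsRecurrence P a b) (n : ℕ) :
    b (n + 2) = 4 * (n + 2) * (n + 2 + α) * (n + 2 + β) * (n + 2 + α + β) /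
      ((2 * n + 4 + α + β) ^ 2 * (2 * n + 5 + α + β) * (2 * n + 3 + α + β)) := by
  have hP' := (isMonicJacobi_iff hα hβ).1 hP
  have hL : ∀ p, p ≠ 0 → 0 < jacobiFunctional hα hβ (p * p) :=
    fun _ => jacobiFunctional_mul_self_pos hα hβ
  have hn : (0 : ℝ) ≤ n := n.cast_nonneg
  rw [hP'.recurrence_offDiag_succ h, hP.diag_succ hα hβ h,
    hP'.coeff_pred hL (jacobiFunctional_pearson hα hβ) (by linarith),
    hP'.coeff_pred_pred hL (jacobiFunctional_pearson hα hβ) (by linarith),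
    hP'.coeff_pred_pred hL (jacobiFunctional_pearson hα hβ) (by linarith)]
  push_cast
  obtain ⟨t, ht⟩ : ∃ t, 2 * (n : ℝ) + 4 + α + β = t := ⟨_, rfl⟩
  obtain rfl : α = t - 2 * n - 4 - β := by linarith
  have h₁ : t ≠ 0 := by linarith
  have h₂ : t + 1 ≠ 0 := by linarith
  have h₃ : t - 1 ≠ 0 := by linarith
  have h₄ : t + 2 ≠ 0 := by linarith
  rw [show 2 * (n : ℝ) + 4 + (t - 2 * n - 4 - β + β) = t by ring,
    show 2 * (n : ℝ) + 3 + (t - 2 * n - 4 - β + β) = t - 1 by ring,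
    show 2 * ((n : ℝ) + 1) + 4 + (t - 2 * n - 4 - β + β) = t + 2 by ring,
    show 2 * ((n : ℝ) + 1) + 3 + (t - 2 * n - 4 - β + β) = t + 1 by ring,
    show 2 * ((n : ℝ) + 1) + 2 + (t - 2 * n - 4 - β + β) = t by ring,
    show 2 * ((n : ℝ) + 1) + 2 + (t - 2 * n - 4 - β) + β = t by ring,
    show 2 * ((n : ℝ) + 1) + 4 + (t - 2 * n - 4 - β) + β = t + 2 by ring,
    show 2 * (n : ℝ) + 4 + (t - 2 * n - 4 - β) + β = t by ring,
    show 2 * (n : ℝ) + 5 + (t - 2 * n - 4 - β) + β = t + 1 by ring,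
    show 2 * (n : ℝ) + 3 + (t - 2 * n - 4 - β) + β = t - 1 by ring]
  field_simp
  ring

/-- The cases `n = 0` and `n = 1` stand apart because the general formulas for `a 0` and `b 1` have
the factors `α + β` and `α + β + 1` in their denominators. -/
theorem IsMonicJacobi.difference_equation (hα : -1 < α) (hβ : -1 < β) (hP : IsMonicJacobi α β P)
    (h : IsRecurrence P a b) (n : ℕ) :
    b (n + 1) * jacobiR α β ((n : ℤ) + 1) - b n * jacobiR α β ((n : ℤ) - 1) =
      (1 - a n ^ 2) / 2 := by
  simp only [jacobiR]
  match n with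
  | 0 =>
    rw [h.1, hP.offDiag_one hα hβ h, hP.diag_zero hα hβ h]
    have h₂ : α + β + 2 ≠ 0 := by linarith
    have h₃ : α + β + 3 ≠ 0 := by linarith
    push_cast
    field_simp
    ring
  | 1 =>
    rw [hP.offDiag_one hα hβ h, hP.diag_succ hα hβ h, hP.offDiag_add_two hα hβ h]
    obtain ⟨t, ht⟩ : ∃ t, α + β + 2 = t := ⟨_, rfl⟩
    obtain rfl : α = t - 2 - β := by linarith
    have h₂ : t ≠ 0 := by linarith
    have h₃ : t + 1 ≠ 0 := by linarith
    have h₄ : t + 2 ≠ 0 := by linarith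
    have h₅ : t + 3 ≠ 0 := by linarith
    push_cast
    rw [show 2 * (0 : ℝ) + 2 + (t - 2 - β) + β = t by ring,
      show 2 * (0 : ℝ) + 4 + (t - 2 - β) + β = t + 2 by ring,
      show 2 * (0 : ℝ) + 5 + (t - 2 - β) + β = t + 3 by ring,
      show 2 * (0 : ℝ) + 3 + (t - 2 - β) + β = t + 1 by ring,
      show t - 2 - β + β + 2 = t by ring,
      show t - 2 - β + β + 3 = t + 1 by ring]
    field_simp
    ring
  | n + 2 =>
    have hn : (0 : ℝ) ≤ n := n.cast_nonneg
    rw [hP.diag_succ hα hβ h, hP.offDiag_add_two hα hβ h,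
      hP.offDiag_add_two hα hβ h]
    obtain ⟨t, ht⟩ : ∃ t, 2 * (n : ℝ) + 4 + α + β = t := ⟨_, rfl⟩
    obtain rfl : α = t - 2 * n - 4 - β := by linarith
    have h₁ : t ≠ 0 := by linarith
    have h₂ : t + 1 ≠ 0 := by linarith
    have h₃ : t - 1 ≠ 0 := by linarith
    have h₄ : t + 2 ≠ 0 := by linarith
    have h₅ : t + 3 ≠ 0 := by linarith
    push_cast
    rw [show 2 * ((n : ℝ) + 1) + 4 + (t - 2 * n - 4 - β) + β = t + 2 by ring,
      show 2 * ((n : ℝ) + 1) + 5 + (t - 2 * n - 4 - β) + β = t + 3 by ring,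
      show 2 * ((n : ℝ) + 1) + 3 + (t - 2 * n - 4 - β) + β = t + 1 by ring,
      show 2 * ((n : ℝ) + 1) + 2 + (t - 2 * n - 4 - β) + β = t by ring,
      show 2 * (n : ℝ) + 4 + (t - 2 * n - 4 - β) + β = t by ring,
      show 2 * (n : ℝ) + 5 + (t - 2 * n - 4 - β) + β = t + 1 by ring,
      show 2 * (n : ℝ) + 3 + (t - 2 * n - 4 - β) + β = t - 1 by ring]
    field_simp
    ring

end Jacobi

theorem mainTheorem2 (α β : ℝ) (hα : -1 < α) (hβ : -1 < β) :
    -- the monic Jacobi polynomials exist and are unique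
    (∃! P : ℕ → Polynomial ℝ, IsMonicJacobi α β P) ∧
    ∀ P : ℕ → Polynomial ℝ, IsMonicJacobi α β P →
      -- so do their recurrence coefficients
      (∃! c : (ℕ → ℝ) × (ℕ → ℝ), IsRecurrence P c.1 c.2) ∧
      ∀ a b : ℕ → ℝ, IsRecurrence P a b →
        -- the integral representation of `R_n`
        (0 < β → ∀ n : ℕ,
          IntervalIntegrable
            (fun y : ℝ => (P n).eval y ^ 2 / (1 + y) * jacobiWeight α β y)
            MeasureTheory.volume (-1) 1 ∧
          β / jacobiNorm α β P n *
            ∫ y in (-1 : ℝ)..1, (P n).eval y ^ 2 / (1 + y) * jacobiWeight α β y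
              = jacobiR α β n) ∧
        -- the difference equation
        (∀ n : ℕ, b (n + 1) * jacobiR α β ((n : ℤ) + 1) - b n * jacobiR α β ((n : ℤ) - 1)
          = (1 - a n ^ 2) / 2) ∧
        -- the initial value
        b 1 = 4 * (α + 1) * (β + 1) / ((α + β + 2) ^ 2 * (α + β + 3)) ∧
        -- the difference equation and the initial value determine `b`
        (∀ y : ℕ → ℝ,
          y 1 = 4 * (α + 1) * (β + 1) / ((α + β + 2) ^ 2 * (α + β + 3)) →
          (∀ n : ℕ, 1 ≤ n →
            y (n + 1) * jacobiR α β ((n : ℤ) + 1) - y n * jacobiR α β ((n : ℤ) - 1)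
              = (1 - a n ^ 2) / 2) →
          ∀ n : ℕ, 1 ≤ n → y n = b n) ∧
        -- the closed form; the excluded case is the only one of the form 0 / 0
        (∀ n : ℕ, 1 ≤ n → ¬ (n = 1 ∧ α + β = -1) →
          b n = 4 * n * (n + α) * (n + β) * (n + α + β) /
            ((2 * n + α + β) ^ 2 * (2 * n + α + β + 1) * (2 * n + α + β - 1))) := by
  have hL : ∀ p, p ≠ 0 → 0 < jacobiFunctional hα hβ (p * p) :=
    fun _ => jacobiFunctional_mul_self_pos hα hβ
  refine ⟨?_, fun P hP => ?_⟩
  · obtain ⟨P, hP⟩ := IsMonicOrthogonal.exists_of_pos hL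
    exact ⟨P, (isMonicJacobi_iff hα hβ).2 hP,
      fun Q hQ => ((isMonicJacobi_iff hα hβ).1 hQ).unique hL hP⟩
  have hP' := (isMonicJacobi_iff hα hβ).1 hP
  refine ⟨?_, fun a b h => ⟨fun hβ₀ n => ⟨?_, ?_⟩, hP.difference_equation hα hβ h,
    hP.offDiag_one hα hβ h, fun y hy₁ hy n hn => ?_, fun n hn hne => ?_⟩⟩
  · obtain ⟨a, b, h⟩ := hP'.exists_isRecurrence hL
    refine ⟨(a, b), h, fun c hc => ?_⟩
    obtain ⟨h₁, h₂⟩ := hP'.isRecurrence_unique hc h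
    exact Prod.ext h₁ h₂
  · have := intervalIntegrable_div_mul_jacobiWeight hα hβ₀ (P n ^ 2)
    simpa only [Polynomial.eval_pow] using this
  · have hpos : 0 < jacobiNorm α β P n := by
      rw [jacobiNorm_eq hα hβ]
      exact hL _ (hP'.monic n).ne_zero
    have := hP.two_mul_mul_integral hα hβ₀ n
    rw [div_mul_eq_mul_div, div_eq_iff hpos.ne', jacobiR]
    push_cast
    linear_combination this / 2
  · induction n, hn using Nat.le_induction with
    | base => rw [hy₁, hP.offDiag_one hα hβ h]
    | succ n hn ih =>
      have e₁ := hy n hn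
      have e₂ := hP.difference_equation hα hβ h n
      -- The coefficient of `y (n + 1)` is positive, so the equation can be solved for it.
      have hR : jacobiR α β ((n : ℤ) + 1) ≠ 0 := by
        have : (0 : ℝ) ≤ n := n.cast_nonneg
        rw [jacobiR]
        push_cast
        linarith
      rw [ih] at e₁
      exact mul_right_cancel₀ hR (by linarith)
  · match n with
    | 1 =>
      -- This factor cancels between numerator and denominator; it vanishes exactly in the excluded
      -- case.
      have hne' : 1 + α + β ≠ 0 := fun h0 => hne ⟨rfl, by linarith⟩
      have h₂ : α + β + 2 ≠ 0 := by linarith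
      have h₃ : α + β + 3 ≠ 0 := by linarith
      rw [hP.offDiag_one hα hβ h]
      push_cast
      rw [show 2 * (1 : ℝ) + α + β + 1 = α + β + 3 by ring,
        show 2 * (1 : ℝ) + α + β - 1 = 1 + α + β by ring,
        show 2 * (1 : ℝ) + α + β = α + β + 2 by ring]
      field_simp
      ring
    | n + 2 =>
      rw [hP.offDiag_add_two hα hβ h]
      push_cast
      congr 1; ring
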